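/- Let $p\ge 0$ be an integer, $V=\{1,\dots,p\}$, and let $F:2^V\to\mathbb{R}$ be submodular (i.e. $F(A)+F(B)\ge F(A\cup B)+F(A\cap B)$ for all $A,B\subseteq V$) and nondecreasing with $F(\varnothing)=0$. For $s\in\mathbb{R}^p$ and $A\subseteq V$ write $s(A)=\sum_{k\in A}s_k$ and $|s|=(|s_k|)_k$. Let $f$ be the Lovász extension of $F$: for $w\in\mathbb{R}_+^p$ with $w_{j_1}\ge\dots\ge w_{j_p}$, $f(w)=\sum_{k=1}^p w_{j_k}\,[F(\{j_1,\dots,j_k\})-F(\{j_1,\dots,j_{k-1}\})]$; and let $\Omega(w)=f(|w|)$ for $w\in\mathbb{R}^p$. For a set-function $G$ with $G(\varnothing)=0$ let $$P(G)=\{t\in\mathbb{R}^p:\ t(A)\le G(A)\ \forall A\subseteq V\},\qquad \mathcal{B}(G)=\{u\in P(G):\ u(V)=G(V)\}.$$ The minimum-norm-point algorithm minimizes a submodular $G$ by computing the point $u$ of smallest Euclidean norm in the base polyhedron $\mathcal{B}(G)$ and returning the sets $\{u<0\}=\{k:u_k<0\}$ and $\{u\le 0\}=\{k:u_k\le 0\}$,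 together with $u$ as certificate; a variant computes instead the point $t$ of smallest Euclidean norm in $P(G)$. Let $z\in\mathbb{R}^p$, $\lambda>0$, and $G(A)=\lambda F(A)-|z|(A)$. Then $G$ is submodular; the proximal problem $$\min_{w\in\mathbb{R}^p}\ \tfrac12\|w-z\|_2^2+\lambda\,\Omega(w)$$ has a unique solution, and so do the minimum-norm problems over $P(G)$ and over $\mathcal{B}(G)$. Solving the proximal problem is equivalent to minimizing $G$ by the minimum-norm-point algorithm, in the following sense. (i) If $u$ is the minimum-norm point of $\mathcal{B}(G)$, then $\{u<0\}$ is the smallest and $\{u\le 0\}$ the largest minimizer of $G$, and $\min_A G(A)=\sum_k\min\{0,u_k\}$. (ii) If $t$ is the minimum-norm point of $P(G)$, then $w$ solves the proximal problem if and only if $w_k=\operatorname{sign}(z_k)\,(-t_k)$ for all $k$. If $u$ is the minimum-norm point of $\mathcal{B}(G)$, then $w$ solves the proximal problem if and only if $w_k=\operatorname{sign}(z_k)\max\{-u_k,0\}$ for all $k$. (Here $\operatorname{sign}(0)=0$.) (iii) Conversely, let $w$ solve the proximal problem. Then $t$ is the minimum-norm point of $P(G)$ if and only if $t=-|w|$;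 and $u$ is the minimum-norm point of $\mathcal{B}(G)$ if and only if it is a point of smallest norm in $\{v\in\mathcal{B}(G):\ v_k=-|w_k|\text{ whenever }w_k\ne0\}$. Moreover the support $\{k:w_k\neq0\}$ is the smallest minimizer of $G$; a set $A$ minimizes $G$ if and only if $G(A)=-\sum_k|w_k|$; there is $u\in\mathcal{B}(G)$ with $u\ge-|w|$ componentwise, and every such $u$ is an optimality certificate, i.e. $\min_A G(A)=\sum_k\min\{0,u_k\}$. -/

import Mathlib

namespace SubmodularNorm

/-- Submodularity of a set-function on the subsets of `V = Fin p`. -/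
def Submodular {p : ℕ} (G : Finset (Fin p) → ℝ) : Prop :=
  ∀ A B : Finset (Fin p), G (A ∪ B) + G (A ∩ B) ≤ G A + G B

/-- An ordering `j₁, …, j_p` of the indices along which `w` is decreasing. -/
noncomputable def decreasingOrder {p : ℕ} (w : Fin p → ℝ) : Equiv.Perm (Fin p) :=
  Tuple.sort (fun k => -w k)

theorem antitone_decreasingOrder {p : ℕ} (w : Fin p → ℝ) :
    Antitone (w ∘ decreasingOrder w) := by
  intro i j hij
  have h := Tuple.monotone_sort (fun k => -w k) hij
  simpa [decreasingOrder] using h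

/-- The Lovász extension (Choquet integral) of `F`:
`f(w) = ∑ₖ w_{jₖ} (F {j₁, …, jₖ} - F {j₁, …, jₖ₋₁})`, where `w_{j₁} ≥ ⋯ ≥ w_{j_p}`. -/
noncomputable def lovaszExtension {p : ℕ} (F : Finset (Fin p) → ℝ) (w : Fin p → ℝ) : ℝ :=
  ∑ k : Fin p, w (decreasingOrder w k) *
    (F ((Finset.Iic k).image (decreasingOrder w)) - F ((Finset.Iio k).image (decreasingOrder w)))

/-- The structured norm `Ω(w) = f(|w|)`. -/
noncomputable def Omega {p : ℕ} (F : Finset (Fin p) → ℝ) (w : EuclideanSpace ℝ (Fin p)) : ℝ :=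
  lovaszExtension F (fun k => |w k|)

/-- `w` minimizes `½ ‖w - z‖₂² + lam * Ω(w)` over `ℝ^p`. -/
def IsProx {p : ℕ} (F : Finset (Fin p) → ℝ) (lam : ℝ) (z w : EuclideanSpace ℝ (Fin p)) : Prop :=
  ∀ v : EuclideanSpace ℝ (Fin p),
    1 / 2 * ‖w - z‖ ^ 2 + lam * Omega F w ≤ 1 / 2 * ‖v - z‖ ^ 2 + lam * Omega F v

/-- The set-function `A ↦ lam * F(A) - |z|(A)`. -/
def proxSetFun {p : ℕ} (F : Finset (Fin p) → ℝ) (lam : ℝ) (z : EuclideanSpace ℝ (Fin p))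
    (A : Finset (Fin p)) : ℝ :=
  lam * F A - ∑ k ∈ A, |z k|

/-- The polyhedron `{t ∈ ℝ^p | t(A) ≤ G(A) for all A}` (no sign constraint on `t`). -/
def polyhedron {p : ℕ} (G : Finset (Fin p) → ℝ) : Set (EuclideanSpace ℝ (Fin p)) :=
  {t | ∀ A : Finset (Fin p), ∑ k ∈ A, t k ≤ G A}

/-- The base polyhedron `{u ∈ ℝ^p | u(A) ≤ G(A) for all A, u(V) = G(V)}`. -/
def basePolyhedron {p : ℕ} (G : Finset (Fin p) → ℝ) : Set (EuclideanSpace ℝ (Fin p)) :=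
  {u | (∀ A : Finset (Fin p), ∑ k ∈ A, u k ≤ G A) ∧ ∑ k, u k = G Finset.univ}

/-- `t` is a point of `K` of smallest Euclidean norm. -/
def IsMinNormPoint {p : ℕ} (K : Set (EuclideanSpace ℝ (Fin p)))
    (t : EuclideanSpace ℝ (Fin p)) : Prop :=
  t ∈ K ∧ ∀ s ∈ K, ‖t‖ ≤ ‖s‖

/-- `A` minimizes the set-function `G`. -/
def IsMinimizer {p : ℕ} (G : Finset (Fin p) → ℝ) (A : Finset (Fin p)) : Prop :=
  ∀ B : Finset (Fin p), G A ≤ G B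

end SubmodularNorm

namespace SubmodularNorm

variable {p : ℕ}

/-! ### The greedy vector -/

/-! Two facts carry the proof. The greedy vector of a submodular function along an ordering lies in
its base polyhedron and is tight on the initial segments of that ordering. A pairing `∑ w k * x k`
with `w ≥ 0` is a nonnegative combination of the sums of `x` over superlevel sets of `w`
(`sum_mul_superlevel`).

Comparing the minimum-norm point `u` of the base polyhedron with the greedy vector that orders `u`
increasingly shows that `u` is tight on all its sublevel sets. This yields the extreme minimizers of
`G`, and shows that truncating `u` at `0` gives the minimum-norm point `t` of `P(G)`.

The link with the proximal problem is duality: the Lovász extension is the support function of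
`P(F)` on nonnegative vectors, and `|z| + t` attains it, up to the factor `lam`, in the direction
`-t`. The objective at any `v` then exceeds its value at `sign(z) * (-t)` by at least an explicit
sum of nonnegative terms, which vanishes only at that point. -/

theorem sum_marginal_le {H : Finset (Fin p) → ℝ} (hH : Submodular H) (h0 : H ∅ = 0)
    (S : Finset (Fin p)) : ∑ i ∈ S, (H (Finset.Iic i) - H (Finset.Iio i)) ≤ H S := by
  induction S using Finset.induction_on_max with
  | empty => simp [h0]
  | insert a S hS ih =>
    have ha : a ∉ S := fun h => lt_irrefl _ (hS a h)
    rw [Finset.sum_insert ha]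
    -- Diminishing returns: adding the maximum `a` to `S` gains at least as much as adding it to the
    -- larger set `Iio a`.
    have h := hH (insert a S) (Finset.Iio a)
    have h1 : insert a S ∪ Finset.Iio a = Finset.Iic a := by
      ext x
      simp only [Finset.mem_union, Finset.mem_insert, Finset.mem_Iio, Finset.mem_Iic]
      constructor
      · rintro ((rfl | h) | h)
        exacts [le_rfl, (hS x h).le, h.le]
      · intro h
        rcases h.eq_or_lt with h | h
        exacts [Or.inl (Or.inl h), Or.inr h]
    have h2 : insert a S ∩ Finset.Iio a = S := by
      ext x
      simp only [Finset.mem_inter, Finset.mem_insert, Finset.mem_Iio]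
      constructor
      · rintro ⟨rfl | h, h'⟩
        exacts [absurd h' (lt_irrefl _), h]
      · exact fun h => ⟨Or.inr h, hS x h⟩
    rw [h1, h2] at h
    linarith

theorem sum_marginal_eq {H : Finset (Fin p) → ℝ} (h0 : H ∅ = 0)
    (S : Finset (Fin p)) (hS : IsLowerSet (S : Set (Fin p))) :
    ∑ i ∈ S, (H (Finset.Iic i) - H (Finset.Iio i)) = H S := by
  induction S using Finset.induction_on_max with
  | empty => simp [h0]
  | insert a S hlt ih =>
    have ha : a ∉ S := fun h => lt_irrefl _ (hlt a h)
    have h2 : S = Finset.Iio a := by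
      ext x
      rw [Finset.mem_Iio]
      refine ⟨hlt x, fun hx => ?_⟩
      have := hS hx.le (by simp : a ∈ ((insert a S : Finset (Fin p)) : Set (Fin p)))
      simpa [hx.ne] using this
    have h1 : insert a S = Finset.Iic a := by
      rw [h2]; exact Finset.Iio_insert a
    rw [Finset.sum_insert ha, ih (by rw [h2, Finset.coe_Iio]; exact isLowerSet_Iio a), h1, ← h2]
    ring

/-- The greedy vector of `G` along the ordering `σ`. -/
def greedy (σ : Equiv.Perm (Fin p)) (G : Finset (Fin p) → ℝ) : EuclideanSpace ℝ (Fin p) :=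
  WithLp.toLp 2 fun k =>
    G ((Finset.Iic (σ.symm k)).image σ) - G ((Finset.Iio (σ.symm k)).image σ)

theorem sum_image_greedy (σ : Equiv.Perm (Fin p)) (G : Finset (Fin p) → ℝ)
    (S : Finset (Fin p)) :
    ∑ k ∈ S.image σ, greedy σ G k =
      ∑ i ∈ S, (G ((Finset.Iic i).image σ) - G ((Finset.Iio i).image σ)) := by
  rw [Finset.sum_image σ.injective.injOn]
  simp [greedy]

theorem image_image_symm (σ : Equiv.Perm (Fin p)) (A : Finset (Fin p)) :
    (A.image σ.symm).image σ = A := by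
  simp [Finset.image_image]

theorem greedy_mem_polyhedron {G : Finset (Fin p) → ℝ} (hG : Submodular G) (h0 : G ∅ = 0)
    (σ : Equiv.Perm (Fin p)) : greedy σ G ∈ polyhedron G := by
  intro A
  rw [← image_image_symm σ A, sum_image_greedy]
  refine sum_marginal_le (H := fun S => G (S.image σ)) ?_ (by simpa using h0) _
  intro A B
  simpa only [Finset.image_union, Finset.image_inter _ _ σ.injective] using
    hG (A.image σ) (B.image σ)

theorem sum_greedy_superlevel {G : Finset (Fin p) → ℝ} (h0 : G ∅ = 0)
    (σ : Equiv.Perm (Fin p)) {w : Fin p → ℝ} (hw : Antitone (w ∘ σ)) (a : ℝ) :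
    ∑ k with a < w k, greedy σ G k = G {k | a < w k} := by
  rw [← image_image_symm σ ({k | a < w k} : Finset (Fin p)), sum_image_greedy]
  refine sum_marginal_eq (H := fun S => G (S.image σ)) (by simpa using h0) _ ?_
  intro i j hji hi
  simp only [Finset.coe_image, Finset.coe_filter, Finset.mem_univ, true_and, Set.mem_image,
    Set.mem_ofPred_eq] at hi ⊢
  obtain ⟨k, hk, rfl⟩ := hi
  refine ⟨σ j, ?_, by simp⟩
  have h := hw hji
  simp only [Function.comp_apply, Equiv.apply_symm_apply] at h
  linarith

theorem greedy_mem_basePolyhedron {G : Finset (Fin p) → ℝ} (hG : Submodular G) (h0 : G ∅ = 0)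
    (σ : Equiv.Perm (Fin p)) : greedy σ G ∈ basePolyhedron G := by
  refine ⟨greedy_mem_polyhedron hG h0 σ, ?_⟩
  -- The zero function has all of `V` as superlevel set at level `-1`.
  have h := sum_greedy_superlevel (w := fun _ => (0 : ℝ)) h0 σ (fun _ _ _ => le_rfl) (-1)
  simpa using h

theorem lovaszExtension_eq_sum_greedy (F : Finset (Fin p) → ℝ) (w : Fin p → ℝ) :
    lovaszExtension F w = ∑ k, w k * greedy (decreasingOrder w) F k := by
  rw [← Equiv.sum_comp (decreasingOrder w)]
  simp [lovaszExtension, greedy]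

/-! ### Summation by superlevel sets -/

/-- Abel summation, by peeling off the lowest layer: with `m` the least positive value, `w = m *
1_{w > 0} + max (w - m) 0`, and the remainder has smaller support. Each layer has positive
thickness, so a total that is not positive forces every superlevel sum to vanish. -/
theorem sum_mul_superlevel {w : Fin p → ℝ} (hw : ∀ k, 0 ≤ w k) (x : Fin p → ℝ)
    (hx : ∀ a, 0 ≤ a → 0 ≤ ∑ k with a < w k, x k) :
    0 ≤ ∑ k, w k * x k ∧
      (∑ k, w k * x k ≤ 0 → ∀ a, 0 ≤ a → ∑ k with a < w k, x k = 0) := by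
  induction hn : (Finset.univ.filter fun k => 0 < w k).card using Nat.strong_induction_on
    generalizing w with
  | _ n ih =>
  rcases (Finset.univ.filter fun k => 0 < w k).eq_empty_or_nonempty with he | hne
  · have hz : ∀ k, w k = 0 := fun k => by
      have : k ∉ Finset.univ.filter fun k => 0 < w k := by simp [he]
      simp only [Finset.mem_filter, Finset.mem_univ, true_and, not_lt] at this
      exact le_antisymm this (hw k)
    refine ⟨by simp [hz], fun _ a ha => ?_⟩
    simp [hz, not_lt.mpr ha]
  · obtain ⟨j, hj, hmin⟩ := Finset.exists_min_image _ w hne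
    simp only [Finset.mem_filter, Finset.mem_univ, true_and] at hj hmin
    set m := w j with hm
    have hlev : ∀ a, 0 ≤ a → ∀ k, a < max (w k - m) 0 ↔ a + m < w k := fun a ha k => by
      rw [lt_max_iff, lt_sub_iff_add_lt]
      exact ⟨fun h => h.resolve_right ha.not_gt, Or.inl⟩
    have hlow : ∀ a, 0 ≤ a → a < m → ∀ k, a < w k ↔ 0 < w k := fun a ha ham k =>
      ⟨fun h => ha.trans_lt h, fun h => ham.trans_le (hmin k h)⟩
    have hx' : ∀ a, 0 ≤ a → 0 ≤ ∑ k with a < max (w k - m) 0, x k := fun a ha => by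
      simp only [hlev a ha]
      exact hx _ (by linarith)
    have hcard : (Finset.univ.filter fun k => 0 < max (w k - m) 0).card < n := by
      rw [← hn]
      apply Finset.card_lt_card
      rw [Finset.ssubset_iff_of_subset]
      · exact ⟨j, by simpa using hj, by simp [hm]⟩
      · intro k
        simp only [Finset.mem_filter, Finset.mem_univ, true_and, hlev 0 le_rfl]
        intro h
        linarith
    obtain ⟨ih1, ih2⟩ := ih _ hcard (fun k => le_max_right _ _) hx' rfl
    have hsplit : ∑ k, w k * x k =
        m * ∑ k with 0 < w k, x k + ∑ k, max (w k - m) 0 * x k := by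
      rw [Finset.sum_filter, Finset.mul_sum, ← Finset.sum_add_distrib]
      refine Finset.sum_congr rfl fun k _ => ?_
      by_cases hk : 0 < w k
      · rw [if_pos hk, max_eq_left (by linarith [hmin k hk])]
        ring
      · rw [if_neg hk, max_eq_right (by linarith), le_antisymm (not_lt.mp hk) (hw k)]
        ring
    have hpos := hx 0 le_rfl
    have hmp := mul_nonneg hj.le hpos
    refine ⟨by rw [hsplit]; exact add_nonneg hmp ih1, fun h a ha => ?_⟩
    rw [hsplit] at h
    rcases lt_or_ge a m with ham | ham
    · simp only [hlow a ha ham]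
      have : m * ∑ k with 0 < w k, x k = 0 := by linarith
      exact (mul_eq_zero.mp this).resolve_left hj.ne'
    · have := ih2 (by linarith) (a - m) (by linarith)
      simpa only [hlev (a - m) (by linarith), sub_add_cancel] using this

theorem sum_mul_le_lovaszExtension {F : Finset (Fin p) → ℝ} (h0 : F ∅ = 0)
    {s : EuclideanSpace ℝ (Fin p)} (hs : s ∈ polyhedron F) {w : Fin p → ℝ} (hw : ∀ k, 0 ≤ w k) :
    ∑ k, w k * s k ≤ lovaszExtension F w := by
  rw [lovaszExtension_eq_sum_greedy, ← sub_nonneg, ← Finset.sum_sub_distrib]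
  have h := (sum_mul_superlevel hw (fun k => greedy (decreasingOrder w) F k - s k)
    (fun a _ => by
      rw [Finset.sum_sub_distrib, sum_greedy_superlevel h0 _ (antitone_decreasingOrder w)]
      exact sub_nonneg.mpr (hs _))).1
  simpa only [mul_sub] using h

/-! ### Points of smallest norm -/

theorem norm_le_norm_iff_sum (s t : EuclideanSpace ℝ (Fin p)) :
    ‖t‖ ≤ ‖s‖ ↔ ∑ k, t k ^ 2 ≤ ∑ k, s k ^ 2 := by
  rw [← EuclideanSpace.real_norm_sq_eq, ← EuclideanSpace.real_norm_sq_eq]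
  exact (pow_le_pow_iff_left₀ (norm_nonneg _) (norm_nonneg _) two_ne_zero).symm

theorem isMinNormPoint_of_sum {K : Set (EuclideanSpace ℝ (Fin p))}
    {t : EuclideanSpace ℝ (Fin p)} (ht : t ∈ K)
    (h : ∀ s ∈ K, ∑ k, t k ^ 2 ≤ ∑ k, t k * s k) : IsMinNormPoint K t := by
  refine ⟨ht, fun s hs => (norm_le_norm_iff_sum s t).mpr ?_⟩
  have h1 : 0 ≤ ∑ k, (s k - t k) ^ 2 := Finset.sum_nonneg fun k _ => sq_nonneg _
  have h2 : ∑ k, (s k - t k) ^ 2 = ∑ k, s k ^ 2 - 2 * ∑ k, t k * s k + ∑ k, t k ^ 2 := by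
    rw [Finset.mul_sum, ← Finset.sum_sub_distrib, ← Finset.sum_add_distrib]
    exact Finset.sum_congr rfl fun k _ => by ring
  linarith [h s hs]

/-- The variational inequality `⟪t, s - t⟫ ≥ 0` for the projection of `0` onto a convex set. -/
theorem IsMinNormPoint.sum_sq_le {K : Set (EuclideanSpace ℝ (Fin p))} (hK : Convex ℝ K)
    {t : EuclideanSpace ℝ (Fin p)} (ht : IsMinNormPoint K t)
    {s : EuclideanSpace ℝ (Fin p)} (hs : s ∈ K) : ∑ k, t k ^ 2 ≤ ∑ k, t k * s k := by
  have : Nonempty K := ⟨⟨t, ht.1⟩⟩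
  have hinf : ‖0 - t‖ = ⨅ w : K, ‖0 - (w : EuclideanSpace ℝ (Fin p))‖ := by
    apply le_antisymm
    · exact le_ciInf fun w => by simpa using ht.2 w w.2
    · exact ciInf_le (f := fun w : K => ‖0 - (w : EuclideanSpace ℝ (Fin p))‖)
        ⟨0, by rintro _ ⟨w, rfl⟩; exact norm_nonneg _⟩ ⟨t, ht.1⟩
  have h := (norm_eq_iInf_iff_real_inner_le_zero hK ht.1).mp hinf s hs
  rw [PiLp.inner_apply] at h
  have h2 : ∑ k, t k ^ 2 - ∑ k, t k * s k =
      ∑ k, inner ℝ ((0 - t : EuclideanSpace ℝ (Fin p)) k) ((s - t) k) := by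
    rw [← Finset.sum_sub_distrib]
    refine Finset.sum_congr rfl fun k _ => ?_
    simp
    ring
  linarith

theorem IsMinNormPoint.unique {K : Set (EuclideanSpace ℝ (Fin p))} (hK : Convex ℝ K)
    {s t : EuclideanSpace ℝ (Fin p)} (hs : IsMinNormPoint K s) (ht : IsMinNormPoint K t) :
    s = t := by
  have h1 := hs.sum_sq_le hK ht.1
  have h2 := ht.sum_sq_le hK hs.1
  have h3 : ∑ k, (s k - t k) ^ 2 =
      (∑ k, s k ^ 2 - ∑ k, s k * t k) + (∑ k, t k ^ 2 - ∑ k, t k * s k) := by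
    rw [← Finset.sum_sub_distrib, ← Finset.sum_sub_distrib, ← Finset.sum_add_distrib]
    exact Finset.sum_congr rfl fun k _ => by ring
  have h4 : ∑ k, (s k - t k) ^ 2 = 0 :=
    le_antisymm (by linarith) (Finset.sum_nonneg fun k _ => sq_nonneg _)
  ext k
  have := (Finset.sum_eq_zero_iff_of_nonneg fun k _ => sq_nonneg (s k - t k)).mp h4 k
    (Finset.mem_univ k)
  exact sub_eq_zero.mp (pow_eq_zero_iff two_ne_zero |>.mp this)

theorem existsUnique_isMinNormPoint {K : Set (EuclideanSpace ℝ (Fin p))} (hK : Convex ℝ K)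
    (hc : IsClosed K) (hne : K.Nonempty) : ∃! t, IsMinNormPoint K t := by
  obtain ⟨t, htK, ht⟩ := hc.exists_infDist_eq_dist hne 0
  refine ⟨t, ⟨htK, fun s hs => ?_⟩, fun s hs => ?_⟩
  · have := Metric.infDist_le_dist_of_mem (x := (0 : EuclideanSpace ℝ (Fin p))) hs
    rw [ht] at this
    simpa using this
  · refine hs.unique hK ⟨htK, fun s hs => ?_⟩
    have := Metric.infDist_le_dist_of_mem (x := (0 : EuclideanSpace ℝ (Fin p))) hs
    rw [ht] at this
    simpa using this

theorem convex_polyhedron (G : Finset (Fin p) → ℝ) : Convex ℝ (polyhedron G) := by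
  intro x hx y hy a b ha hb hab A
  simp only [PiLp.add_apply, PiLp.smul_apply, smul_eq_mul, Finset.sum_add_distrib,
    ← Finset.mul_sum]
  calc a * ∑ k ∈ A, x k + b * ∑ k ∈ A, y k ≤ a * G A + b * G A :=
        add_le_add (mul_le_mul_of_nonneg_left (hx A) ha) (mul_le_mul_of_nonneg_left (hy A) hb)
    _ = G A := by rw [← add_mul, hab, one_mul]

theorem isClosed_polyhedron (G : Finset (Fin p) → ℝ) : IsClosed (polyhedron G) := by
  have : polyhedron G = ⋂ A : Finset (Fin p), {t | ∑ k ∈ A, t k ≤ G A} := by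
    ext; simp [polyhedron]
  rw [this]
  exact isClosed_iInter fun A => isClosed_le (by fun_prop) continuous_const

theorem basePolyhedron_eq (G : Finset (Fin p) → ℝ) :
    basePolyhedron G = polyhedron G ∩ {u | ∑ k, u k = G Finset.univ} := rfl

theorem convex_basePolyhedron (G : Finset (Fin p) → ℝ) : Convex ℝ (basePolyhedron G) := by
  rw [basePolyhedron_eq]
  refine (convex_polyhedron G).inter ?_
  intro x hx y hy a b ha hb hab
  simp only [Set.mem_ofPred_eq] at hx hy
  simp only [Set.mem_ofPred_eq, PiLp.add_apply, PiLp.smul_apply, smul_eq_mul,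
    Finset.sum_add_distrib, ← Finset.mul_sum]
  rw [hx, hy, ← add_mul, hab, one_mul]

theorem isClosed_basePolyhedron (G : Finset (Fin p) → ℝ) : IsClosed (basePolyhedron G) := by
  rw [basePolyhedron_eq]
  exact (isClosed_polyhedron G).inter (isClosed_eq (by fun_prop) continuous_const)

theorem polyhedron_of_le {G : Finset (Fin p) → ℝ} {s t : EuclideanSpace ℝ (Fin p)}
    (hs : s ∈ polyhedron G) (h : ∀ k, t k ≤ s k) : t ∈ polyhedron G := fun A =>
  (Finset.sum_le_sum fun k _ => h k).trans (hs A)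

/-! ### The minimum-norm point of the base polyhedron -/

/-- With `w = c - u ≥ 0` and `g` greedy along `w`, the superlevel sums of `g - u` are nonnegative,
while minimality of `u` gives `∑ w k * (g k - u k) ≤ 0`. The equality case of `sum_mul_superlevel`
makes `u` as tight as `g`. -/
theorem IsMinNormPoint.sum_sublevel_eq {G : Finset (Fin p) → ℝ} (hG : Submodular G)
    (h0 : G ∅ = 0) {u : EuclideanSpace ℝ (Fin p)} (hu : IsMinNormPoint (basePolyhedron G) u)
    (a : ℝ) : ∑ k with u k < a, u k = G {k | u k < a} := by
  obtain ⟨c, hc⟩ : ∃ c : ℝ, a ≤ c ∧ ∀ k, u k ≤ c := by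
    obtain ⟨c, hc⟩ := (Set.finite_range fun k => u k).bddAbove
    exact ⟨max a c, le_max_left _ _, fun k => (hc ⟨k, rfl⟩).trans (le_max_right _ _)⟩
  set w : Fin p → ℝ := fun k => c - u k with hw
  set g := greedy (decreasingOrder w) G with hg
  have hgB : g ∈ basePolyhedron G := greedy_mem_basePolyhedron hG h0 _
  have hgl : ∀ b, ∑ k with b < w k, g k = G {k | b < w k} := fun b =>
    sum_greedy_superlevel h0 _ (antitone_decreasingOrder w) b
  have key := (sum_mul_superlevel (w := w) (fun k => sub_nonneg.mpr (hc.2 k))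
    (fun k => g k - u k) (fun b _ => by
      rw [Finset.sum_sub_distrib, hgl]
      exact sub_nonneg.mpr (hu.1.1 _))).2 (by
    have h1 := hu.sum_sq_le (convex_basePolyhedron G) hgB
    have h2 : ∑ k, w k * (g k - u k) =
        c * (∑ k, g k - ∑ k, u k) + (∑ k, u k ^ 2 - ∑ k, u k * g k) := by
      rw [← Finset.sum_sub_distrib, ← Finset.sum_sub_distrib, Finset.mul_sum,
        ← Finset.sum_add_distrib]
      exact Finset.sum_congr rfl fun k _ => by rw [hw]; ring
    rw [h2, hgB.2, hu.1.2]
    linarith) (c - a) (by linarith [hc.1])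
  rw [Finset.sum_sub_distrib, hgl] at key
  have hset : ∀ k, c - a < w k ↔ u k < a := fun k => by
    rw [hw]; exact sub_lt_sub_iff_left c
  simp only [hset] at key
  linarith

theorem sum_min_le_sum (u : Fin p → ℝ) (A : Finset (Fin p)) :
    ∑ k, min 0 (u k) ≤ ∑ k ∈ A, u k := by
  rw [← Finset.sum_add_sum_compl A]
  have h1 : ∑ k ∈ A, min 0 (u k) ≤ ∑ k ∈ A, u k :=
    Finset.sum_le_sum fun k _ => min_le_right _ _
  have h2 : ∑ k ∈ Aᶜ, min 0 (u k) ≤ 0 := Finset.sum_nonpos fun k _ => min_le_left _ _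
  linarith

theorem subset_of_sum_eq_sum_min {u : Fin p → ℝ} {A : Finset (Fin p)}
    (h : ∑ k ∈ A, u k ≤ ∑ k, min 0 (u k)) :
    ({k | u k < 0} : Finset (Fin p)) ⊆ A ∧ A ⊆ ({k | u k ≤ 0} : Finset (Fin p)) := by
  have hle : ∀ k ∈ Finset.univ, min 0 (u k) ≤ if k ∈ A then u k else 0 := fun k _ => by
    split_ifs
    exacts [min_le_right _ _, min_le_left _ _]
  have hA : ∑ k ∈ A, u k = ∑ k, if k ∈ A then u k else 0 := by simp
  have heq := (Finset.sum_eq_sum_iff_of_le hle).mp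
    (le_antisymm (Finset.sum_le_sum hle) (hA ▸ h))
  constructor
  · intro k hk
    by_contra hkA
    have := heq k (Finset.mem_univ k)
    rw [if_neg hkA] at this
    simp only [Finset.mem_filter, Finset.mem_univ, true_and] at hk
    linarith [min_le_right 0 (u k)]
  · intro k hk
    have := heq k (Finset.mem_univ k)
    rw [if_pos hk] at this
    simp only [Finset.mem_filter, Finset.mem_univ, true_and]
    linarith [min_le_left 0 (u k)]

theorem sum_neg_eq_sum_min (u : Fin p → ℝ) : ∑ k with u k < 0, u k = ∑ k, min 0 (u k) := by
  rw [Finset.sum_filter]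
  refine Finset.sum_congr rfl fun k _ => ?_
  split_ifs with h
  exacts [(min_eq_right h.le).symm, (min_eq_left (not_lt.mp h)).symm]

theorem sum_nonpos_eq_sum_min (u : Fin p → ℝ) : ∑ k with u k ≤ 0, u k = ∑ k, min 0 (u k) := by
  rw [Finset.sum_filter]
  refine Finset.sum_congr rfl fun k _ => ?_
  split_ifs with h
  exacts [(min_eq_right h).symm, (min_eq_left (not_le.mp h).le).symm]

theorem IsMinNormPoint.sum_nonpos_eq {G : Finset (Fin p) → ℝ} (hG : Submodular G)
    (h0 : G ∅ = 0) {u : EuclideanSpace ℝ (Fin p)} (hu : IsMinNormPoint (basePolyhedron G) u) :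
    ∑ k with u k ≤ 0, u k = G {k | u k ≤ 0} := by
  -- Take `a` to be the least positive value of `u`, or `1` if there is none, to turn the weak
  -- sublevel set into a strict one.
  obtain ⟨a, ha⟩ : ∃ a : ℝ, ∀ k, u k ≤ 0 ↔ u k < a := by
    rcases (Finset.univ.filter fun k => 0 < u k).eq_empty_or_nonempty with he | hne
    · refine ⟨1, fun k => ⟨fun h => by linarith, fun _ => ?_⟩⟩
      have : k ∉ Finset.univ.filter fun k => 0 < u k := by simp [he]
      simpa using this
    · obtain ⟨j, hj, hmin⟩ := Finset.exists_min_image _ (fun k => u k) hne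
      simp only [Finset.mem_filter, Finset.mem_univ, true_and] at hj hmin
      exact ⟨u j, fun k => ⟨fun h => h.trans_lt hj,
        fun h => not_lt.mp fun h' => (hmin k h').not_gt h⟩⟩
  simp only [ha]
  exact hu.sum_sublevel_eq hG h0 a

theorem sum_min_le {G : Finset (Fin p) → ℝ} {u : EuclideanSpace ℝ (Fin p)}
    (hu : u ∈ basePolyhedron G) (A : Finset (Fin p)) : ∑ k, min 0 (u k) ≤ G A :=
  (sum_min_le_sum (fun k => u k) A).trans (hu.1 A)

theorem IsMinNormPoint.isMinimizer {G : Finset (Fin p) → ℝ} (hG : Submodular G)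
    (h0 : G ∅ = 0) {u : EuclideanSpace ℝ (Fin p)} (hu : IsMinNormPoint (basePolyhedron G) u) :
    IsMinimizer G {k | u k < 0} ∧ IsMinimizer G {k | u k ≤ 0} ∧
      ∀ A, (IsMinimizer G A ↔ G A = ∑ k, min 0 (u k)) ∧ (IsMinimizer G A →
        ({k | u k < 0} : Finset (Fin p)) ⊆ A ∧ A ⊆ ({k | u k ≤ 0} : Finset (Fin p))) := by
  have h1 := hu.sum_sublevel_eq hG h0 0
  have h2 := hu.sum_nonpos_eq hG h0
  rw [sum_neg_eq_sum_min fun k => u k] at h1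
  rw [sum_nonpos_eq_sum_min fun k => u k] at h2
  have hiff : ∀ A, IsMinimizer G A ↔ G A = ∑ k, min 0 (u k) := fun A =>
    ⟨fun h => le_antisymm ((h _).trans h1.ge) (sum_min_le hu.1 A),
      fun h B => h.le.trans (sum_min_le hu.1 B)⟩
  exact ⟨(hiff _).mpr h1.symm, (hiff _).mpr h2.symm, fun A => ⟨hiff A, fun h =>
    subset_of_sum_eq_sum_min ((hu.1.1 A).trans ((hiff A).mp h).le)⟩⟩

/-- Superlevel sets of `-min 0 u` at levels `a ≥ 0` are sublevel sets of `u`, where `u` is tight and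
so dominates every `s` in `P(G)` in sum. Layer summation turns this into the variational inequality.
-/
theorem IsMinNormPoint.min_zero {G : Finset (Fin p) → ℝ} (hG : Submodular G)
    (h0 : G ∅ = 0) {u : EuclideanSpace ℝ (Fin p)} (hu : IsMinNormPoint (basePolyhedron G) u) :
    IsMinNormPoint (polyhedron G) (WithLp.toLp 2 fun k => min 0 (u k)) := by
  refine isMinNormPoint_of_sum (polyhedron_of_le hu.1.1 fun k => min_le_right _ _) ?_
  intro s hs
  have hlev : ∀ a : ℝ, 0 ≤ a → ∀ k, a < -min 0 (u k) ↔ u k < -a := fun a ha k => by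
    rw [lt_neg, min_lt_iff]
    exact ⟨fun h => h.resolve_left (by linarith), Or.inr⟩
  have h := (sum_mul_superlevel (w := fun k => -min 0 (u k))
    (fun k => neg_nonneg.mpr (min_le_left _ _)) (fun k => u k - s k) (fun a ha => by
      simp only [hlev a ha]
      rw [Finset.sum_sub_distrib, hu.sum_sublevel_eq hG h0]
      exact sub_nonneg.mpr (hs _))).1
  have h2 : ∑ k, -min 0 (u k) * (u k - s k) =
      ∑ k, min 0 (u k) * s k - ∑ k, min 0 (u k) ^ 2 := by
    rw [← Finset.sum_sub_distrib]
    refine Finset.sum_congr rfl fun k _ => ?_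
    rcases le_total 0 (u k) with hk | hk
    · simp [min_eq_left hk]
    · rw [min_eq_right hk]; ring
  rw [h2] at h
  exact sub_nonneg.mp h

/-! ### The proximal problem -/

theorem submodular_proxSetFun {F : Finset (Fin p) → ℝ} (hF : Submodular F) {lam : ℝ}
    (hlam : 0 ≤ lam) (z : EuclideanSpace ℝ (Fin p)) : Submodular (proxSetFun F lam z) := by
  intro A B
  have h1 := mul_le_mul_of_nonneg_left (hF A B) hlam
  have h2 := Finset.sum_union_inter (s₁ := A) (s₂ := B) (f := fun k => |z k|)
  simp only [proxSetFun]
  linarith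

theorem IsMinNormPoint.polyhedron_nonpos {G : Finset (Fin p) → ℝ}
    {t : EuclideanSpace ℝ (Fin p)} (ht : IsMinNormPoint (polyhedron G) t) (k : Fin p) :
    t k ≤ 0 := by
  -- `P(G)` is closed downwards, so this truncation is a competitor of no larger norm; uniqueness
  -- identifies it with `t`.
  have hmem : (WithLp.toLp 2 fun k => min 0 (t k) : EuclideanSpace ℝ (Fin p)) ∈ polyhedron G :=
    polyhedron_of_le ht.1 fun k => min_le_right _ _
  have h := ht.unique (convex_polyhedron G) ⟨hmem, fun s hs => le_trans
    ((norm_le_norm_iff_sum _ _).mpr (Finset.sum_le_sum fun k _ => ?_)) (ht.2 s hs)⟩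
  · have := congrArg (fun v : EuclideanSpace ℝ (Fin p) => v k) h
    exact min_eq_right_iff.mp this.symm
  · rcases le_total 0 (t k) with hk | hk
    · simp only [min_eq_left hk]
      nlinarith
    · simp only [min_eq_right hk]
      exact le_rfl

/-- Raising `t` to `-|z|` where it is lower stays in `P(G)`: raised coordinates contribute nothing
to `t + |z|`, and monotonicity of `F` absorbs their removal from `A`. The norm does not grow since
`t ≤ 0`. -/
theorem IsMinNormPoint.neg_abs_le {F : Finset (Fin p) → ℝ} (hmono : Monotone F) {lam : ℝ}
    (hlam : 0 ≤ lam) {z t : EuclideanSpace ℝ (Fin p)}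
    (ht : IsMinNormPoint (polyhedron (proxSetFun F lam z)) t) (k : Fin p) : -|z k| ≤ t k := by
  have hmem : (WithLp.toLp 2 fun k => max (-|z k|) (t k) : EuclideanSpace ℝ (Fin p)) ∈
      polyhedron (proxSetFun F lam z) := by
    intro A
    have h1 := ht.1 (A.filter fun k => -|z k| ≤ t k)
    have h2 := mul_le_mul_of_nonneg_left
      (hmono (Finset.filter_subset (fun k => -|z k| ≤ t k) A)) hlam
    have h3 : ∑ k ∈ A, max (-|z k|) (t k) + ∑ k ∈ A, |z k| =
        ∑ k ∈ A with -|z k| ≤ t k, t k + ∑ k ∈ A with -|z k| ≤ t k, |z k| := by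
      rw [← Finset.sum_add_distrib, ← Finset.sum_add_distrib, Finset.sum_filter]
      refine Finset.sum_congr rfl fun k _ => ?_
      split_ifs with hk
      · rw [max_eq_right hk]
      · rw [max_eq_left (not_le.mp hk).le]; ring
    simp only [proxSetFun] at h1 ⊢
    linarith
  have h := ht.unique (convex_polyhedron _) ⟨hmem, fun s hs => le_trans
    ((norm_le_norm_iff_sum _ _).mpr (Finset.sum_le_sum fun k _ => ?_)) (ht.2 s hs)⟩
  · have := congrArg (fun v : EuclideanSpace ℝ (Fin p) => v k) h
    exact max_eq_right_iff.mp this.symm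
  · have h0 := ht.polyhedron_nonpos k
    have hz := abs_nonneg (z k)
    have h1 : t k ≤ max (-|z k|) (t k) := le_max_right _ _
    have h2 : max (-|z k|) (t k) ≤ 0 := max_le (by linarith) h0
    simp only
    nlinarith

theorem IsMinNormPoint.abs_sign_mul {F : Finset (Fin p) → ℝ} (hmono : Monotone F) {lam : ℝ}
    (hlam : 0 ≤ lam) {z t : EuclideanSpace ℝ (Fin p)}
    (ht : IsMinNormPoint (polyhedron (proxSetFun F lam z)) t) (k : Fin p) :
    |Real.sign (z k) * (-t k)| = -t k := by
  have h1 := ht.polyhedron_nonpos k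
  have h2 := ht.neg_abs_le hmono hlam k
  rcases lt_trichotomy (z k) 0 with h | h | h
  · rw [Real.sign_of_neg h, abs_mul, abs_of_nonneg (neg_nonneg.mpr h1)]; simp
  · rw [h, abs_zero] at h2
    simp [h]; linarith
  · rw [Real.sign_of_pos h, one_mul, abs_of_nonneg (neg_nonneg.mpr h1)]

/-- The variational inequality at `t` against `lam * g - |z|`, with `g` greedy for `F` along `-t`.
With `mul_lovaszExtension_ge` it becomes an equality. -/
theorem IsMinNormPoint.lovaszExtension_neg {F : Finset (Fin p) → ℝ} (hF : Submodular F)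
    (h0 : F ∅ = 0) {lam : ℝ} (hlam : 0 ≤ lam) {z t : EuclideanSpace ℝ (Fin p)}
    (ht : IsMinNormPoint (polyhedron (proxSetFun F lam z)) t) :
    lam * lovaszExtension F (fun k => -t k) ≤ ∑ k, -t k * (t k + |z k|) := by
  rw [lovaszExtension_eq_sum_greedy]
  set g := greedy (decreasingOrder fun k => -t k) F with hg
  have hmem : (WithLp.toLp 2 fun k => lam * g k - |z k| : EuclideanSpace ℝ (Fin p)) ∈
      polyhedron (proxSetFun F lam z) := by
    intro A
    have := mul_le_mul_of_nonneg_left (greedy_mem_polyhedron hF h0 _ A :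
      ∑ k ∈ A, g k ≤ F A) hlam
    simp only [proxSetFun, Finset.sum_sub_distrib, ← Finset.mul_sum]
    linarith
  have h := ht.sum_sq_le (convex_polyhedron _) hmem
  rw [← sub_nonneg, ← Finset.sum_sub_distrib] at h
  rw [← sub_nonneg, Finset.mul_sum, ← Finset.sum_sub_distrib]
  refine h.trans_eq (Finset.sum_congr rfl fun k _ => ?_)
  simp only
  ring

theorem mul_lovaszExtension_ge {F : Finset (Fin p) → ℝ} (h0 : F ∅ = 0) {lam : ℝ}
    (hlam : 0 < lam) {z t : EuclideanSpace ℝ (Fin p)}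
    (ht : t ∈ polyhedron (proxSetFun F lam z)) {w : Fin p → ℝ} (hw : ∀ k, 0 ≤ w k) :
    ∑ k, w k * (t k + |z k|) ≤ lam * lovaszExtension F w := by
  have hmem : (WithLp.toLp 2 fun k => lam⁻¹ * (t k + |z k|) : EuclideanSpace ℝ (Fin p)) ∈
      polyhedron F := by
    intro A
    have := ht A
    simp only [proxSetFun] at this
    simp only [← Finset.mul_sum, Finset.sum_add_distrib]
    rw [inv_mul_le_iff₀ hlam]
    linarith
  have h := mul_le_mul_of_nonneg_left (sum_mul_le_lovaszExtension h0 hmem hw) hlam.le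
  refine le_trans (le_of_eq ?_) h
  rw [Finset.mul_sum]
  refine Finset.sum_congr rfl fun k _ => ?_
  simp only
  field_simp

/-- The added sum is a quantitative optimality gap: its first part measures `|v|` against `-t`, its
second the sign disagreement of `v` with `z`. -/
theorem IsMinNormPoint.objective_ge {F : Finset (Fin p) → ℝ} (hF : Submodular F)
    (hmono : Monotone F) (h0 : F ∅ = 0) {lam : ℝ} (hlam : 0 < lam)
    {z t w : EuclideanSpace ℝ (Fin p)}
    (ht : IsMinNormPoint (polyhedron (proxSetFun F lam z)) t)
    (hw : ∀ k, w k = Real.sign (z k) * (-t k)) (v : EuclideanSpace ℝ (Fin p)) :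
    1 / 2 * ‖w - z‖ ^ 2 + lam * Omega F w +
      ∑ k, (1 / 2 * (|v k| + t k) ^ 2 + (|v k| * |z k| - v k * z k)) ≤
    1 / 2 * ‖v - z‖ ^ 2 + lam * Omega F v := by
  have habs : ∀ k, |w k| = -t k := fun k => by
    rw [hw]; exact ht.abs_sign_mul hmono hlam.le k
  have h1 := ht.lovaszExtension_neg hF h0 hlam.le
  have h2 := mul_lovaszExtension_ge h0 hlam ht.1 (w := fun k => |v k|) fun k => abs_nonneg _
  have hwz : ∀ k, w k * z k = -t k * |z k| := fun k => by
    rw [hw]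
    rcases lt_trichotomy (z k) 0 with h | h | h
    · rw [Real.sign_of_neg h, abs_of_neg h]; ring
    · simp [h]
    · rw [Real.sign_of_pos h, abs_of_pos h]; ring
  have hΩ : Omega F w = lovaszExtension F (fun k => -t k) := by
    simp only [Omega, habs]
  rw [hΩ, EuclideanSpace.real_norm_sq_eq, EuclideanSpace.real_norm_sq_eq]
  have key : 1 / 2 * ∑ k, (w - z) k ^ 2 + ∑ k, -t k * (t k + |z k|) +
      ∑ k, (1 / 2 * (|v k| + t k) ^ 2 + (|v k| * |z k| - v k * z k)) =
      1 / 2 * ∑ k, (v - z) k ^ 2 + ∑ k, |v k| * (t k + |z k|) := by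
    rw [Finset.mul_sum, Finset.mul_sum, ← Finset.sum_add_distrib, ← Finset.sum_add_distrib,
      ← Finset.sum_add_distrib]
    refine Finset.sum_congr rfl fun k _ => ?_
    have hw2 : w k ^ 2 = t k ^ 2 := by rw [← sq_abs, habs]; ring
    have hv2 := sq_abs (v k)
    simp only [PiLp.sub_apply]
    linear_combination (1 / 2) * hw2 - hwz k + (1 / 2) * hv2
  unfold Omega
  linarith

theorem IsMinNormPoint.isProx_iff {F : Finset (Fin p) → ℝ} (hF : Submodular F)
    (hmono : Monotone F) (h0 : F ∅ = 0) {lam : ℝ} (hlam : 0 < lam)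
    {z t : EuclideanSpace ℝ (Fin p)}
    (ht : IsMinNormPoint (polyhedron (proxSetFun F lam z)) t)
    (v : EuclideanSpace ℝ (Fin p)) :
    IsProx F lam z v ↔ ∀ k, v k = Real.sign (z k) * (-t k) := by
  have hnn : ∀ (v : EuclideanSpace ℝ (Fin p)) (k : Fin p),
      0 ≤ 1 / 2 * (|v k| + t k) ^ 2 ∧ 0 ≤ |v k| * |z k| - v k * z k := fun v k =>
    ⟨by positivity, sub_nonneg.mpr (by rw [← abs_mul]; exact le_abs_self _)⟩
  constructor
  · intro hv k
    have h := ht.objective_ge hF hmono h0 hlam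
      (w := WithLp.toLp 2 fun k => Real.sign (z k) * (-t k)) (fun _ => rfl) v
    have hs : ∑ k, (1 / 2 * (|v k| + t k) ^ 2 + (|v k| * |z k| - v k * z k)) = 0 :=
      le_antisymm (by linarith [hv (WithLp.toLp 2 fun k => Real.sign (z k) * (-t k))])
        (Finset.sum_nonneg fun k _ => add_nonneg (hnn v k).1 (hnn v k).2)
    have hk := (Finset.sum_eq_zero_iff_of_nonneg fun k _ =>
      add_nonneg (hnn v k).1 (hnn v k).2).mp hs k (Finset.mem_univ k)
    obtain ⟨ha, hb⟩ := hnn v k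
    have h1 : (|v k| + t k) ^ 2 = 0 := by linarith
    have h2 : |v k| * |z k| = v k * z k := by linarith
    have h3 : |v k| = -t k := by
      have := pow_eq_zero_iff two_ne_zero |>.mp h1
      linarith
    rcases lt_trichotomy (z k) 0 with h | h | h
    · rw [Real.sign_of_neg h, ← h3]
      rw [abs_of_neg h] at h2
      have := mul_right_cancel₀ h.ne (show -|v k| * z k = v k * z k by linarith)
      linarith
    -- Where `z k = 0` the sign carries no information, but the bounds on `t` force `t k = 0`.
    · have h4 := ht.neg_abs_le hmono hlam.le k
      rw [h, abs_zero, neg_zero] at h4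
      rw [h, Real.sign_zero, zero_mul, ← abs_nonpos_iff]
      linarith
    · rw [Real.sign_of_pos h, ← h3, one_mul]
      rw [abs_of_pos h] at h2
      exact (mul_right_cancel₀ h.ne' h2).symm
  · intro hv x
    have h := ht.objective_ge hF hmono h0 hlam hv x
    have := Finset.sum_nonneg fun k (_ : k ∈ Finset.univ) =>
      add_nonneg (hnn x k).1 (hnn x k).2
    linarith

end SubmodularNorm

theorem proposition3 (p : ℕ) (F : Finset (Fin p) → ℝ)
    (hsub : SubmodularNorm.Submodular F) (hmono : Monotone F) (hzero : F ∅ = 0)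
    (z : EuclideanSpace ℝ (Fin p)) (lam : ℝ) (hlam : 0 < lam)
    (G : Finset (Fin p) → ℝ) (hG : G = SubmodularNorm.proxSetFun F lam z) :
    -- `G` is submodular, and the three convex problems have unique solutions
    SubmodularNorm.Submodular G ∧
    (∃! w, SubmodularNorm.IsProx F lam z w) ∧
    (∃! t, SubmodularNorm.IsMinNormPoint (SubmodularNorm.polyhedron G) t) ∧
    (∃! u, SubmodularNorm.IsMinNormPoint (SubmodularNorm.basePolyhedron G) u) ∧
    -- the minimum-norm point of the base polyhedron gives the minimum of `G`, its smallest and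
    -- its largest minimizer, and an optimality certificate
    (∀ u, SubmodularNorm.IsMinNormPoint (SubmodularNorm.basePolyhedron G) u →
      SubmodularNorm.IsMinimizer G {k | u k < 0} ∧
      SubmodularNorm.IsMinimizer G {k | u k ≤ 0} ∧
      (∀ A, SubmodularNorm.IsMinimizer G A →
        ({k | u k < 0} : Finset (Fin p)) ⊆ A ∧ A ⊆ ({k | u k ≤ 0} : Finset (Fin p)) ∧
        G A = ∑ k, min 0 (u k))) ∧
    -- from a minimum-norm point (either version) to the proximal problem
    (∀ t, SubmodularNorm.IsMinNormPoint (SubmodularNorm.polyhedron G) t →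
      ∀ w, SubmodularNorm.IsProx F lam z w ↔ ∀ k, w k = Real.sign (z k) * (-t k)) ∧
    (∀ u, SubmodularNorm.IsMinNormPoint (SubmodularNorm.basePolyhedron G) u →
      ∀ w, SubmodularNorm.IsProx F lam z w ↔ ∀ k, w k = Real.sign (z k) * max (-u k) 0) ∧
    -- from the proximal problem to the minimum-norm points and to the minimization of `G`
    (∀ w, SubmodularNorm.IsProx F lam z w →
      (∀ t, SubmodularNorm.IsMinNormPoint (SubmodularNorm.polyhedron G) t ↔
        ∀ k, t k = -|w k|) ∧
      (∀ u, SubmodularNorm.IsMinNormPoint (SubmodularNorm.basePolyhedron G) u ↔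
        SubmodularNorm.IsMinNormPoint
          {v | v ∈ SubmodularNorm.basePolyhedron G ∧ ∀ k, w k ≠ 0 → v k = -|w k|} u) ∧
      SubmodularNorm.IsMinimizer G {k | w k ≠ 0} ∧
      (∀ A, SubmodularNorm.IsMinimizer G A →
        ({k | w k ≠ 0} : Finset (Fin p)) ⊆ A) ∧
      (∀ A, SubmodularNorm.IsMinimizer G A ↔ G A = -∑ k, |w k|) ∧
      (∃ u ∈ SubmodularNorm.basePolyhedron G, ∀ k, -|w k| ≤ u k) ∧
      (∀ u ∈ SubmodularNorm.basePolyhedron G, (∀ k, -|w k| ≤ u k) →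
        ∀ A, SubmodularNorm.IsMinimizer G A → G A = ∑ k, min 0 (u k))) := by
  subst hG
  have hG := SubmodularNorm.submodular_proxSetFun hsub hlam.le z
  have h0 : SubmodularNorm.proxSetFun F lam z ∅ = 0 := by simp [SubmodularNorm.proxSetFun, hzero]
  set G := SubmodularNorm.proxSetFun F lam z with hGdef
  have hgB := SubmodularNorm.greedy_mem_basePolyhedron hG h0 1
  have hexP := SubmodularNorm.existsUnique_isMinNormPoint (SubmodularNorm.convex_polyhedron G) (SubmodularNorm.isClosed_polyhedron G)
    ⟨_, hgB.1⟩
  have hexB := SubmodularNorm.existsUnique_isMinNormPoint (SubmodularNorm.convex_basePolyhedron G) (SubmodularNorm.isClosed_basePolyhedron G)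
    ⟨_, hgB⟩
  obtain ⟨u₀, hu₀, -⟩ := id hexB
  have hu₀t := hu₀.min_zero hG h0
  have hmin := hu₀.isMinimizer hG h0
  refine ⟨hG, ?_, hexP, hexB, ?_, ?_, ?_, ?_⟩
  · exact ⟨WithLp.toLp 2 fun k => Real.sign (z k) * (-min 0 (u₀ k)),
      (hu₀t.isProx_iff hsub hmono hzero hlam _).mpr fun _ => rfl,
      fun v hv => by ext k; exact (hu₀t.isProx_iff hsub hmono hzero hlam v).mp hv k⟩
  · intro u hu
    obtain ⟨h1, h2, h3⟩ := hu.isMinimizer hG h0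
    exact ⟨h1, h2, fun A hA => ⟨((h3 A).2 hA).1, ((h3 A).2 hA).2, (h3 A).1.mp hA⟩⟩
  · intro t ht w
    exact ht.isProx_iff hsub hmono hzero hlam w
  · intro u hu w
    rw [(hu.min_zero hG h0).isProx_iff hsub hmono hzero hlam w]
    simp only [← max_neg_neg, neg_zero, max_comm]
  · intro w hw
    have habs : ∀ k, min 0 (u₀ k) = -|w k| := fun k => by
      have h1 := (hu₀t.isProx_iff hsub hmono hzero hlam w).mp hw k
      have h2 := hu₀t.abs_sign_mul hmono hlam.le k
      rw [← h1] at h2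
      rw [h2, neg_neg]
    have hneg : ∀ k, w k ≠ 0 ↔ u₀ k < 0 := fun k => by
      rw [← abs_pos, ← neg_lt_zero, ← habs, min_lt_iff]
      simp
    have hsum : ∑ k, min 0 (u₀ k) = -∑ k, |w k| := by
      simp only [habs, Finset.sum_neg_distrib]
    have hle : ∀ k, -|w k| ≤ u₀ k := fun k => habs k ▸ min_le_right _ _
    have hiff : ∀ A, SubmodularNorm.IsMinimizer G A ↔ G A = -∑ k, |w k| := fun A => by
      rw [(hmin.2.2 A).1, hsum]
    have hu₀S : ∀ k, w k ≠ 0 → u₀ k = -|w k| := fun k hk => by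
      rw [← habs, min_eq_right ((hneg k).mp hk).le]
    refine ⟨?_, ?_, ?_, ?_, hiff, ⟨u₀, hu₀.1, hle⟩, ?_⟩
    · intro t
      constructor
      · intro ht k
        rw [ht.unique (SubmodularNorm.convex_polyhedron G) hu₀t]
        exact habs k
      · intro ht
        convert hu₀t using 1
        ext k
        rw [ht, ← habs]
    -- The constrained set lies in the base polyhedron and contains `u₀`, so both problems have the
    -- same minimal norm.
    · intro u
      constructor
      · intro hu
        obtain rfl := hu.unique (SubmodularNorm.convex_basePolyhedron G) hu₀
        exact ⟨⟨hu.1, hu₀S⟩, fun s hs => hu.2 s hs.1⟩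
      · intro hu
        exact ⟨hu.1.1, fun s hs => (hu.2 u₀ ⟨hu₀.1, hu₀S⟩).trans (hu₀.2 s hs)⟩
    · simp only [hneg]
      exact hmin.1
    · intro A hA
      simp only [hneg]
      exact ((hmin.2.2 A).2 hA).1
    -- Sandwich: `-|w k| ≤ min 0 (u k)` termwise, and the sum of the right sides never exceeds a
    -- value of `G`.
    · intro u hu hwu A hA
      refine le_antisymm ?_ (SubmodularNorm.sum_min_le hu A)
      rw [(hiff A).mp hA, ← Finset.sum_neg_distrib]
      exact Finset.sum_le_sum fun k _ => le_min (by simp) (hwu k)
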